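/- For a set $X\subset\mathbb{R}^3$ let $A(X)=\{d(x,y) : x,y\in X,\ x\neq y\}$, where $d$ is the Euclidean distance. Call $X$ an $s$-distance set if $|A(X)|=s$. The diameter graph $DG(X)$ is the graph with vertex set $X$ in which two points $p,q$ are adjacent if and only if $d(p,q)=\max A(X)$. The independence number $\alpha(G)$ of a graph $G$ is the maximum cardinality of a set of pairwise nonadjacent vertices. (1) Every $5$-distance set $X\subset\mathbb{R}^3$ with at least $20$ points has a subset $Y\subseteq X$ with exactly $8$ points that is an $s$-distance set for some $s\le 4$. (2) For every $X\subset\mathbb{R}^3$ with $|X|=20$, one has $\alpha(DG(X))\ge 8$. -/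

import Mathlib

/-- `A(X)`: the set of Euclidean distances between two distinct points of `X`. -/
def distanceValues {d : ℕ} (X : Set (EuclideanSpace ℝ (Fin d))) : Set ℝ :=
  {r | ∃ x ∈ X, ∃ y ∈ X, x ≠ y ∧ dist x y = r}

/-- `X` is an `s`-distance set: exactly `s` distances occur between distinct points of `X`. -/
def IsDistanceSet {d : ℕ} (s : ℕ) (X : Set (EuclideanSpace ℝ (Fin d))) : Prop :=
  (distanceValues X).encard = s

/-- The diameter graph of `X`: its vertices are the points of `X`, and two points are adjacent
when their distance is the maximum of `A(X)`. (As `0` is not in `A(X)`, there are no loops.) -/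
def diameterGraph {d : ℕ} (X : Set (EuclideanSpace ℝ (Fin d))) : SimpleGraph X where
  Adj p q := IsGreatest (distanceValues X)
    (dist (p : EuclideanSpace ℝ (Fin d)) (q : EuclideanSpace ℝ (Fin d)))
  symm := ⟨fun p q h => by rwa [dist_comm]⟩
  loopless := ⟨fun p h => by
    obtain ⟨x, -, y, -, hxy, h0⟩ := h.1
    rw [dist_self] at h0
    exact hxy (dist_eq_zero.1 h0)⟩

/-! Both claims reduce to finding eight independent vertices in the diameter graph of 20 points:
such vertices avoid the largest distance, so a 5-distance set loses one of its distances on them.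

The only geometric input is that two odd closed walks in a diameter graph in `ℝ³` share a vertex
(`exists_common_vertex_of_odd_diameter_walks`). Along a walk `c`, join the vectors `(-1)^i (c (i+1)
- c i)` successively by segments. If the length is odd, this path ends at the antipode of its start,
so it is a one-sided closed curve in the projective plane. Two such curves meet, because they cross
an odd number of times after a generic perturbation (`sum_crossing_eq_one`, `exists_parallel`). At a
meeting point, directions inside the arcs of diameters at a vertex of each walk agree up to sign,
and for disjoint walks this is impossible by metric inequalities (`smul_ne_of_diameters`).

Hence each vertex set or its complement is bipartite, and the rest is graph theory
(`hasIndep_eight`). Without eight independent vertices, all sets of five vertices are bipartite, so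
triangles and 5-cycles are absent. Counting vertices at distances one, two and at least three then
bounds the degree by three. This bound gives four independent vertices in any seven, and a greedy
choice completes eight. -/

/-- The subgraph induced on `S` has a proper colouring with two colours. -/
def TwoColorableOn {V : Type*} (G : SimpleGraph V) (S : Finset V) : Prop :=
  ∃ f : V → Bool, ∀ x ∈ S, ∀ y ∈ S, G.Adj x y → f x ≠ f y

/-- `S` contains an independent set of at least `k` vertices. -/
def HasIndep {V : Type*} (G : SimpleGraph V) (S : Finset V) (k : ℕ) : Prop :=
  ∃ I : Finset V, I ⊆ S ∧ (∀ x ∈ I, ∀ y ∈ I, ¬ G.Adj x y) ∧ k ≤ I.card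

/-! ### Independent sets in graphs where every vertex set or its complement is bipartite. -/

section Combinatorics

open Finset
open scoped Classical

variable {V : Type*} {G : SimpleGraph V}

theorem TwoColorableOn.mono {S T : Finset V} (h : TwoColorableOn G T) (hST : S ⊆ T) :
    TwoColorableOn G S := by
  obtain ⟨f, hf⟩ := h
  exact ⟨f, fun x hx y hy => hf x (hST hx) y (hST hy)⟩

theorem HasIndep.mono {S T : Finset V} {k l : ℕ} (h : HasIndep G S k) (hST : S ⊆ T)
    (hlk : l ≤ k) : HasIndep G T l := by
  obtain ⟨I, h1, h2, h3⟩ := h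
  exact ⟨I, h1.trans hST, h2, hlk.trans h3⟩

theorem TwoColorableOn.exists_split {S : Finset V} (h : TwoColorableOn G S) :
    ∃ P Q : Finset V, P ⊆ S ∧ Q ⊆ S ∧ Disjoint P Q ∧ P.card + Q.card = S.card ∧
      (∀ x ∈ P, ∀ y ∈ P, ¬ G.Adj x y) ∧ (∀ x ∈ Q, ∀ y ∈ Q, ¬ G.Adj x y) := by
  obtain ⟨f, hf⟩ := h
  refine ⟨S.filter (f · = true), S.filter (¬ f · = true), filter_subset _ _, filter_subset _ _,
    disjoint_filter_filter_not _ _ _, card_filter_add_card_filter_not _, ?_, ?_⟩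
  · intro x hx y hy hxy
    rw [mem_filter] at hx hy
    exact hf x hx.1 y hy.1 hxy (hx.2.trans hy.2.symm)
  · intro x hx y hy hxy
    rw [mem_filter] at hx hy
    apply hf x hx.1 y hy.1 hxy
    simp_all

theorem TwoColorableOn.hasIndep {S : Finset V} (h : TwoColorableOn G S) {k : ℕ}
    (hk : 2 * k ≤ S.card + 1) : HasIndep G S k := by
  obtain ⟨P, Q, hP, hQ, -, hc, hPi, hQi⟩ := h.exists_split
  rcases le_or_gt k P.card with h | h
  · exact ⟨P, hP, hPi, h⟩
  · exact ⟨Q, hQ, hQi, by omega⟩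

theorem HasIndep.insert_of_nonadj {S : Finset V} {w : V} (hw : w ∈ S) {k : ℕ}
    (h : HasIndep G (S.filter fun x => x ≠ w ∧ ¬ G.Adj w x) k) : HasIndep G S (k + 1) := by
  obtain ⟨I, h1, h2, h3⟩ := h
  have h4 : ∀ x ∈ I, x ∈ S ∧ x ≠ w ∧ ¬ G.Adj w x := fun x hx => mem_filter.1 (h1 hx)
  refine ⟨insert w I, ?_, ?_, ?_⟩
  · intro x hx
    rcases mem_insert.1 hx with rfl | hx
    · exact hw
    · exact (h4 x hx).1
  · intro x hx y hy hxy
    rw [mem_insert] at hx hy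
    rcases hx with rfl | hx <;> rcases hy with rfl | hy
    · exact G.loopless.irrefl _ hxy
    · exact (h4 y hy).2.2 hxy
    · exact (h4 x hx).2.2 hxy.symm
    · exact h2 x hx y hy hxy
  · rw [card_insert_of_notMem fun hx => (h4 w hx).2.1 rfl]
    omega

theorem card_le_card_nonadj (G : SimpleGraph V) (S : Finset V) (w : V) :
    S.card ≤ (S.filter fun x => x ≠ w ∧ ¬ G.Adj w x).card + 1 + (S.filter (G.Adj w)).card := by
  have : S ⊆ ((S.filter fun x => x ≠ w ∧ ¬ G.Adj w x) ∪ {w}) ∪ S.filter (G.Adj w) := by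
    intro x hx
    simp only [mem_union, mem_filter, mem_singleton]
    tauto
  calc S.card ≤ _ := card_le_card this
    _ ≤ _ := (card_union_le _ _).trans (Nat.add_le_add_right (card_union_le _ _) _)

/-- If all sets of at most five vertices are 2-colourable, neighbourhoods are independent. -/
theorem nonadj_of_common_neighbor (h5 : ∀ S : Finset V, S.card ≤ 5 → TwoColorableOn G S)
    {v x y : V} (hx : G.Adj v x) (hy : G.Adj v y) : ¬ G.Adj x y := by
  intro hxy
  obtain ⟨f, hf⟩ := h5 {v, x, y} (card_le_three.trans (by norm_num))
  have h1 := hf v (by simp) x (by simp) hx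
  have h2 := hf v (by simp) y (by simp) hy
  have h3 := hf x (by simp) y (by simp) hxy
  revert h1 h2 h3
  cases f v <;> cases f x <;> cases f y <;> simp

/-- Otherwise `v, a, x, y, b` would be a closed walk of length five on at most five vertices. -/
theorem nonadj_of_two_steps (h5 : ∀ S : Finset V, S.card ≤ 5 → TwoColorableOn G S)
    {v a b x y : V} (ha : G.Adj v a) (hb : G.Adj v b) (hx : G.Adj a x) (hy : G.Adj b y) :
    ¬ G.Adj x y := by
  intro hxy
  obtain ⟨f, hf⟩ := h5 {v, a, b, x, y} card_le_five
  have h1 := hf v (by simp) a (by simp) ha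
  have h2 := hf v (by simp) b (by simp) hb
  have h3 := hf a (by simp) x (by simp) hx
  have h4 := hf b (by simp) y (by simp) hy
  have h5 := hf x (by simp) y (by simp) hxy
  revert h1 h2 h3 h4 h5
  cases f v <;> cases f x <;> cases f y <;> cases f a <;> cases f b <;> simp

theorem hasIndep_three (h5 : ∀ S : Finset V, S.card ≤ 5 → TwoColorableOn G S)
    {S : Finset V} (hS : 5 ≤ S.card) : HasIndep G S 3 := by
  obtain ⟨T, hT, hc⟩ := exists_subset_card_eq hS
  exact ((h5 T hc.le).hasIndep (by omega)).mono hT le_rfl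

/-- Either some vertex has four neighbours, which are independent, or deleting it with at most three
neighbours leaves five vertices. -/
theorem hasIndep_four_of_nine (h5 : ∀ S : Finset V, S.card ≤ 5 → TwoColorableOn G S)
    {S : Finset V} (hS : 9 ≤ S.card) : HasIndep G S 4 := by
  obtain ⟨w, hw⟩ : S.Nonempty := card_pos.1 (by omega)
  have hc := card_le_card_nonadj G S w
  by_cases hd : 4 ≤ (S.filter (G.Adj w)).card
  · refine ⟨_, filter_subset _ _, ?_, hd⟩
    intro x hx y hy
    exact nonadj_of_common_neighbor h5 (mem_filter.1 hx).2 (mem_filter.1 hy).2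
  · exact (hasIndep_three h5 (by omega)).insert_of_nonadj hw

variable [Fintype V]

/-- The vertices at distance two from `v`. -/
noncomputable def secondNeighbors (G : SimpleGraph V) (v : V) : Finset V :=
  univ.filter fun x => x ≠ v ∧ ¬ G.Adj v x ∧ ∃ a, G.Adj v a ∧ G.Adj a x

/-- The vertices at distance at least three from `v`. -/
noncomputable def farVertices (G : SimpleGraph V) (v : V) : Finset V :=
  univ.filter fun x => x ≠ v ∧ ¬ G.Adj v x ∧ ¬ ∃ a, G.Adj v a ∧ G.Adj a x

theorem card_levels (G : SimpleGraph V) (v : V) :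
    Fintype.card V ≤ 1 + (univ.filter (G.Adj v)).card + (secondNeighbors G v).card +
      (farVertices G v).card := by
  have : (univ : Finset V) ⊆
      (({v} ∪ univ.filter (G.Adj v)) ∪ secondNeighbors G v) ∪ farVertices G v := by
    intro x _
    simp only [mem_union, mem_filter, mem_singleton, secondNeighbors, farVertices, mem_univ,
      true_and]
    by_cases h1 : x = v <;> by_cases h2 : G.Adj v x <;>
      by_cases h3 : ∃ a, G.Adj v a ∧ G.Adj a x <;>
      simp [h1, h2, h3]
  calc Fintype.card V ≤ _ := card_le_card this
    _ ≤ _ := card_union_le _ _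
    _ ≤ _ := Nat.add_le_add_right ((card_union_le _ _).trans
      (Nat.add_le_add_right (card_union_le _ _) _)) _

theorem hasIndep_add_farVertices (h5 : ∀ S : Finset V, S.card ≤ 5 → TwoColorableOn G S) (v : V)
    {k : ℕ} (h : HasIndep G (farVertices G v) k) :
    HasIndep G univ ((univ.filter (G.Adj v)).card + k) := by
  obtain ⟨I, h1, h2, h3⟩ := h
  have h4 : ∀ x ∈ I, x ≠ v ∧ ¬ G.Adj v x ∧ ¬ ∃ a, G.Adj v a ∧ G.Adj a x :=
    fun x hx => (mem_filter.1 (h1 hx)).2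
  refine ⟨univ.filter (G.Adj v) ∪ I, subset_univ _, ?_, ?_⟩
  · intro x hx y hy hxy
    simp only [mem_union, mem_filter, mem_univ, true_and] at hx hy
    rcases hx with hx | hx <;> rcases hy with hy | hy
    · exact nonadj_of_common_neighbor h5 hx hy hxy
    · exact (h4 y hy).2.2 ⟨x, hx, hxy⟩
    · exact (h4 x hx).2.2 ⟨y, hy, hxy.symm⟩
    · exact h2 x hx y hy hxy
  · rw [card_union_of_disjoint]
    · omega
    · rw [disjoint_left]
      intro x hx hxI
      exact (h4 x hxI).2.1 (mem_filter.1 hx).2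

theorem nonadj_insert_secondNeighbors (h5 : ∀ S : Finset V, S.card ≤ 5 → TwoColorableOn G S)
    (v : V) : ∀ x ∈ insert v (secondNeighbors G v), ∀ y ∈ insert v (secondNeighbors G v),
      ¬ G.Adj x y := by
  intro x hx y hy hxy
  simp only [mem_insert, secondNeighbors, mem_filter, mem_univ, true_and] at hx hy
  rcases hx with rfl | ⟨-, hx, a, ha, hax⟩ <;> rcases hy with rfl | ⟨-, hy, b, hb, hby⟩
  · exact G.loopless.irrefl _ hxy
  · exact hy hxy
  · exact hx hxy.symm
  · exact nonadj_of_two_steps h5 ha hb hax hby hxy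

theorem card_insert_secondNeighbors (G : SimpleGraph V) (v : V) :
    (insert v (secondNeighbors G v)).card = (secondNeighbors G v).card + 1 :=
  card_insert_of_notMem (by simp [secondNeighbors])

/-- In a graph of maximum degree three, a minimal vertex set of at most seven vertices that is not
2-colourable, with 2-colourable complement, yields a large independent set. -/
theorem hasIndep_of_minimal_not_twoColorable (hV : Fintype.card V = 20)
    (h5 : ∀ S : Finset V, S.card ≤ 5 → TwoColorableOn G S)
    (h3 : ∀ v, (univ.filter (G.Adj v)).card ≤ 3) {T : Finset V} (hT : ¬ TwoColorableOn G T)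
    (hmin : ∀ c ∈ T, TwoColorableOn G (T.erase c)) (hT7 : T.card ≤ 7)
    (hTc : TwoColorableOn G Tᶜ) : HasIndep G univ 8 := by
  have hT5 : 5 < T.card := by
    by_contra h
    exact hT (h5 T (by omega))
  obtain ⟨P, Q, hP, hQ, hdis, hPQ, hPi, hQi, hle⟩ : ∃ P Q : Finset V, P ⊆ Tᶜ ∧ Q ⊆ Tᶜ ∧
      Disjoint P Q ∧ P.card + Q.card = Tᶜ.card ∧ (∀ x ∈ P, ∀ y ∈ P, ¬ G.Adj x y) ∧
      (∀ x ∈ Q, ∀ y ∈ Q, ¬ G.Adj x y) ∧ Q.card ≤ P.card := by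
    obtain ⟨P, Q, hP, hQ, hdis, hPQ, hPi, hQi⟩ := hTc.exists_split
    rcases le_total Q.card P.card with h | h
    · exact ⟨P, Q, hP, hQ, hdis, hPQ, hPi, hQi, h⟩
    · exact ⟨Q, P, hQ, hP, hdis.symm, by omega, hQi, hPi, h⟩
  rw [card_compl, hV] at hPQ
  have hPd : ∀ x ∈ P, x ∉ T := fun x hx => mem_compl.1 (hP hx)
  have hQd : ∀ x ∈ Q, x ∉ T := fun x hx => mem_compl.1 (hQ hx)
  -- `T` has six or seven vertices, so if `P` has at most seven, then `P` has exactly seven and `Q`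
  -- at least six.
  by_cases hP8 : 8 ≤ P.card
  · exact ⟨P, subset_univ _, hPi, hP8⟩
  by_cases hc : ∃ c ∈ T, ∀ x ∈ P, ¬ G.Adj c x
  · obtain ⟨c, hcT, hc⟩ := hc
    refine HasIndep.insert_of_nonadj (mem_univ c) (k := 7) ⟨P, ?_, hPi, by omega⟩
    intro x hx
    refine mem_filter.2 ⟨mem_univ _, ?_, hc x hx⟩
    rintro rfl
    exact hPd _ hx hcT
  push Not at hc
  -- A vertex with at most one neighbour in `T` could be added back to a 2-colouring of `T.erase c`.
  have hdeg : ∀ c ∈ T, 2 ≤ (T.filter (G.Adj c)).card := by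
    intro c hcT
    by_contra hlt
    obtain ⟨f, hf⟩ := hmin c hcT
    have hle1 : (T.filter (G.Adj c)).card ≤ 1 := by omega
    rw [card_le_one] at hle1
    obtain ⟨b, hb⟩ : ∃ b : Bool, ∀ x ∈ T, G.Adj c x → f x ≠ b := by
      by_cases hex : ∃ x ∈ T, G.Adj c x
      · obtain ⟨x, hx, hcx⟩ := hex
        refine ⟨!f x, fun y hy hcy => ?_⟩
        rw [hle1 y (mem_filter.2 ⟨hy, hcy⟩) x (mem_filter.2 ⟨hx, hcx⟩)]
        simp
      · push Not at hex
        exact ⟨true, fun x hx hcx => absurd hcx (hex x hx)⟩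
    refine hT ⟨fun x => if x = c then b else f x, fun x hx y hy hxy => ?_⟩
    by_cases hxc : x = c <;> by_cases hyc : y = c
    · subst hxc; subst hyc; exact absurd hxy (G.loopless.irrefl _)
    · subst hxc; simpa [hyc] using (hb y hy hxy).symm
    · subst hyc; simpa [hxc] using hb x hx hxy.symm
    · simpa [hxc, hyc] using
        hf x (mem_erase.2 ⟨hxc, hx⟩) y (mem_erase.2 ⟨hyc, hy⟩) hxy
  -- Two neighbours in `T` and one in `P` exhaust the degree, so `Q` can be joined with three
  -- independent vertices of `T`.
  have hTQ : ∀ c ∈ T, ∀ x ∈ Q, ¬ G.Adj c x := by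
    intro c hcT x hx hcx
    obtain ⟨y, hy, hcy⟩ := hc c hcT
    have hxy : x ≠ y := by
      rintro rfl
      exact disjoint_left.1 hdis hy hx
    have hsub : insert x (insert y (T.filter (G.Adj c))) ⊆ univ.filter (G.Adj c) := by
      intro z hz
      simp only [mem_insert, mem_filter, mem_univ, true_and] at hz ⊢
      rcases hz with rfl | rfl | hz
      · exact hcx
      · exact hcy
      · exact hz.2
    have h1 := card_le_card hsub
    rw [card_insert_of_notMem, card_insert_of_notMem] at h1
    · have := hdeg c hcT
      have := h3 c
      omega
    · exact fun h => hPd y hy (mem_filter.1 h).1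
    · simp only [mem_insert, not_or]
      exact ⟨hxy, fun h => hQd x hx (mem_filter.1 h).1⟩
  obtain ⟨I, hI, hIi, hI3⟩ := hasIndep_three h5 hT5.le
  refine ⟨I ∪ Q, subset_univ _, ?_, ?_⟩
  · intro x hx y hy hxy
    rcases mem_union.1 hx with hx | hx <;> rcases mem_union.1 hy with hy | hy
    · exact hIi x hx y hy hxy
    · exact hTQ x (hI hx) y hy hxy
    · exact hTQ y (hI hy) x hx hxy.symm
    · exact hQi x hx y hy hxy
  · rw [card_union_of_disjoint]
    · omega
    · rw [disjoint_left]
      exact fun x hx hxQ => hQd x hxQ (hI hx)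

theorem exists_minimal_not_twoColorable {S : Finset V} (hS : ¬ TwoColorableOn G S) :
    ∃ T ⊆ S, ¬ TwoColorableOn G T ∧ ∀ c ∈ T, TwoColorableOn G (T.erase c) := by
  induction S using Finset.strongInduction with
  | H S ih =>
    by_cases h : ∀ c ∈ S, TwoColorableOn G (S.erase c)
    · exact ⟨S, Subset.rfl, hS, h⟩
    · push Not at h
      obtain ⟨c, hc, hn⟩ := h
      obtain ⟨T, hT, h1, h2⟩ := ih _ (erase_ssubset hc) hn
      exact ⟨T, hT.trans (erase_subset _ _), h1, h2⟩

/-- A graph on 20 vertices in which every vertex set or its complement is 2-colourable has an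
independent set of eight vertices. -/
theorem hasIndep_eight (hV : Fintype.card V = 20)
    (H : ∀ S : Finset V, TwoColorableOn G S ∨ TwoColorableOn G Sᶜ) : HasIndep G univ 8 := by
  by_contra hA
  have h5 : ∀ S : Finset V, S.card ≤ 5 → TwoColorableOn G S := by
    intro S hS
    refine (H S).resolve_right fun h => hA ((h.hasIndep ?_).mono (subset_univ _) le_rfl)
    rw [card_compl, hV]
    omega
  have hN1 : ∀ v, (univ.filter (G.Adj v)).card ≤ 7 := by
    intro v
    by_contra h
    refine hA ⟨_, subset_univ _, fun x hx y hy => ?_, not_le.1 h⟩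
    exact nonadj_of_common_neighbor h5 (mem_filter.1 hx).2 (mem_filter.1 hy).2
  have hN2 : ∀ v, (secondNeighbors G v).card ≤ 6 := by
    intro v
    by_contra h
    refine hA ⟨_, subset_univ _, nonadj_insert_secondNeighbors h5 v, ?_⟩
    rw [card_insert_secondNeighbors]
    omega
  have hfar : ∀ v k, HasIndep G (farVertices G v) k → (univ.filter (G.Adj v)).card + k < 8 := by
    intro v k h
    by_contra hlt
    exact hA ((hasIndep_add_farVertices h5 v h).mono Subset.rfl (not_lt.1 hlt))
  -- Degree four leaves at least 20 - 1 - 4 - 6 = 9 far vertices, hence 4 + 4 independent ones;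
  -- degrees five to seven leave at least six, hence 5 + 3.
  have h3 : ∀ v, (univ.filter (G.Adj v)).card ≤ 3 := by
    intro v
    by_contra h
    have hc := card_levels G v
    rw [hV] at hc
    have := hN1 v
    have := hN2 v
    by_cases h4 : (univ.filter (G.Adj v)).card = 4
    · have := hfar v 4 (hasIndep_four_of_nine h5 (by omega))
      omega
    · have := hfar v 3 (hasIndep_three h5 (by omega))
      omega
  have h7 : ∀ S : Finset V, 7 ≤ S.card → HasIndep G S 4 := by
    intro S hS
    obtain ⟨S', hS', hc⟩ := exists_subset_card_eq hS
    refine HasIndep.mono (TwoColorableOn.hasIndep (S := S') ?_ (by omega)) hS' le_rfl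
    by_contra hn
    obtain ⟨T, hT, hTn, hmin⟩ := exists_minimal_not_twoColorable hn
    exact hA (hasIndep_of_minimal_not_twoColorable hV h5 h3 hTn hmin
      ((card_le_card hT).trans hc.le) ((H T).resolve_left hTn))
  -- Greedy step: choose a vertex and delete it with its at most `d` neighbours.
  have hstep : ∀ (d k n : ℕ) (S : Finset V), 0 < n →
      (∀ w ∈ S, (S.filter (G.Adj w)).card ≤ d) → n + 1 + d ≤ S.card →
      (∀ S' : Finset V, S' ⊆ S → n ≤ S'.card → HasIndep G S' k) → HasIndep G S (k + 1) := by
    intro d k n S hn hd hS hk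
    obtain ⟨w, hw⟩ : S.Nonempty := card_pos.1 (by omega)
    have hc := card_le_card_nonadj G S w
    have := hd w hw
    exact (hk _ (filter_subset _ _) (by omega)).insert_of_nonadj hw
  by_cases hd3 : ∃ v, (univ.filter (G.Adj v)).card = 3
  · obtain ⟨v, hv⟩ := hd3
    have hc := card_levels G v
    rw [hV, hv] at hc
    have hm := hN2 v
    have hnot : ¬ HasIndep G (farVertices G v) 5 := fun h => by
      have := hfar v 5 h
      omega
    -- There are at least `16 - m` far vertices, `m` being the number at distance two. If some `w`
    -- has no neighbour at distance two, it enlarges an independent set, so `m ≤ 5` and 11 = 7 + 1 +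
    -- 3 far vertices suffice. Otherwise degrees among far vertices are at most two, and 10 = 7 + 1
    -- + 2 suffice.
    by_cases hw : ∃ w ∈ farVertices G v, ∀ x ∈ secondNeighbors G v, ¬ G.Adj w x
    · obtain ⟨w, hwR, hw⟩ := hw
      have hw' := (mem_filter.1 hwR).2
      have hm5 : (secondNeighbors G v).card ≤ 5 := by
        by_contra h
        refine hA (HasIndep.insert_of_nonadj (mem_univ w) (k := 7)
          ⟨insert v (secondNeighbors G v), ?_, nonadj_insert_secondNeighbors h5 v, ?_⟩)
        · intro x hx
          refine mem_filter.2 ⟨mem_univ _, ?_⟩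
          rcases mem_insert.1 hx with rfl | hx
          · exact ⟨hw'.1.symm, fun h => hw'.2.1 h.symm⟩
          · refine ⟨?_, hw x hx⟩
            rintro rfl
            exact hw'.2.2 (mem_filter.1 hx).2.2.2
        · rw [card_insert_secondNeighbors]
          omega
      refine hnot (hstep 3 4 7 _ (by norm_num) (fun w _ => ?_) (by omega) fun S _ => h7 S)
      exact (card_le_card (filter_subset_filter _ (subset_univ _))).trans (h3 w)
    · push Not at hw
      refine hnot (hstep 2 4 7 _ (by norm_num) (fun w hwR => ?_) (by omega) fun S _ => h7 S)
      obtain ⟨x, hx, hwx⟩ := hw w hwR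
      have hsub : insert x ((farVertices G v).filter (G.Adj w)) ⊆ univ.filter (G.Adj w) := by
        intro z hz
        rcases mem_insert.1 hz with rfl | hz
        · exact mem_filter.2 ⟨mem_univ _, hwx⟩
        · exact mem_filter.2 ⟨mem_univ _, (mem_filter.1 hz).2⟩
      have h1 := card_le_card hsub
      rw [card_insert_of_notMem] at h1
      · have := h3 w
        omega
      · intro h
        exact (mem_filter.1 (mem_filter.1 h).1).2.2.2 (mem_filter.1 hx).2.2.2
  · push Not at hd3
    have h2 : ∀ (S : Finset V), ∀ w ∈ S, (S.filter (G.Adj w)).card ≤ 2 := by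
      intro S w _
      have := h3 w
      have := hd3 w
      have := card_le_card (filter_subset_filter (G.Adj w) (subset_univ S))
      omega
    -- Degrees are now at most two: four greedy choices go from 20 to 17, 14, 11 and 8 vertices, and
    -- the last eight contain four independent ones.
    refine hA (hstep 2 7 17 _ (by norm_num) (h2 _) (by rw [card_univ, hV]) fun S _ hS => ?_)
    refine hstep 2 6 14 _ (by norm_num) (h2 _) hS fun S _ hS => ?_
    refine hstep 2 5 11 _ (by norm_num) (h2 _) hS fun S _ hS => ?_
    exact hstep 2 4 8 _ (by norm_num) (h2 _) hS fun S _ hS => h7 S (by omega)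

end Combinatorics

/-- A vertex set that is not 2-colourable contains an odd closed walk. -/
theorem exists_odd_closed_walk {V : Type*} {G : SimpleGraph V} {S : Finset V}
    (hS : ¬ TwoColorableOn G S) :
    ∃ (n : ℕ) (c : ℕ → V), Odd n ∧ (∀ i, c i ∈ S) ∧ (∀ i, G.Adj (c i) (c (i + 1))) ∧
      ∀ i, c (i + n) = c i := by
  have h : ¬ (G.induce (S : Set V)).Colorable 2 := by
    rintro ⟨f⟩
    classical
    refine hS ⟨fun x => if hx : x ∈ S then decide (f ⟨x, hx⟩ = 0) else true, ?_⟩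
    intro x hx y hy hxy
    have hne : f ⟨x, hx⟩ ≠ f ⟨y, hy⟩ := f.valid (by simpa using hxy)
    simp only [hx, hy, dif_pos]
    revert hne
    generalize f ⟨x, hx⟩ = a
    generalize f ⟨y, hy⟩ = b
    revert a b
    decide
  rw [SimpleGraph.two_colorable_iff_forall_loop_even] at h
  push Not at h
  obtain ⟨u, p, hp⟩ := h
  rw [Nat.not_even_iff_odd] at hp
  have hpos : 0 < p.length := hp.pos
  refine ⟨p.length, fun i => p.getVert (i % p.length), hp, fun i => (p.getVert _).2, fun i => ?_,
    fun i => by simp⟩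
  have hadj := p.adj_getVert_succ (Nat.mod_lt i hpos)
  have heq : p.getVert ((i + 1) % p.length) = p.getVert (i % p.length + 1) := by
    rcases (Nat.succ_le_of_lt (Nat.mod_lt i hpos)).lt_or_eq with hlt | heq
    · rw [← Nat.mod_add_mod, Nat.mod_eq_of_lt hlt]
    · rw [← Nat.mod_add_mod, ← Nat.succ_eq_add_one (i % p.length), heq]
      simp
  show G.Adj (p.getVert (i % p.length) : V) (p.getVert ((i + 1) % p.length) : V)
  rw [heq]
  exact hadj

/-! ### Crossing numbers modulo two in the projective plane. -/

section Crossings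

/-- The determinant of three vectors of `ℝ³`. -/
def det3 (a b c : Fin 3 → ℝ) : ℝ :=
  a 0 * (b 1 * c 2 - b 2 * c 1) - a 1 * (b 0 * c 2 - b 2 * c 0) + a 2 * (b 0 * c 1 - b 1 * c 0)

/-- The sign of a nonzero real number, as an element of the additive group `ZMod 2`. -/
noncomputable def signBit (t : ℝ) : ZMod 2 := if t < 0 then 1 else 0

/-- The crossing number modulo two of the segments `ab` and `cd`, for vectors in general position
that represent points of the projective plane. -/
noncomputable def crossing (a b c d : Fin 3 → ℝ) : ZMod 2 :=
  (signBit (det3 a b c) + signBit (det3 a b d)) * (signBit (det3 c d a) + signBit (det3 c d b))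

/-- Whether `a` or `-a` lies in the cone spanned by `c`, `d` and `r`. -/
noncomputable def inTriangle (c d r a : Fin 3 → ℝ) : ZMod 2 :=
  signBit (det3 d r a) * signBit (det3 r c a) * signBit (det3 c d a) +
  (signBit (det3 d r a) + 1) * (signBit (det3 r c a) + 1) * (signBit (det3 c d a) + 1)

theorem signBit_neg {t : ℝ} (ht : t ≠ 0) : signBit (-t) = signBit t + 1 := by
  unfold signBit
  rcases lt_or_gt_of_ne ht with h | h
  · rw [if_neg (by linarith), if_pos h]; rfl
  · rw [if_pos (by linarith), if_neg (by linarith)]; rfl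

theorem signBit_mul {s t : ℝ} (hs : s ≠ 0) (ht : t ≠ 0) :
    signBit (s * t) = signBit s + signBit t := by
  unfold signBit
  rcases lt_or_gt_of_ne hs with h | h <;> rcases lt_or_gt_of_ne ht with h' | h'
  · rw [if_neg (by nlinarith), if_pos h, if_pos h']; rfl
  · rw [if_pos (by nlinarith), if_pos h, if_neg (by linarith)]; rfl
  · rw [if_pos (by nlinarith), if_neg (by linarith), if_pos h']; rfl
  · rw [if_neg (by nlinarith), if_neg (by linarith), if_neg (by linarith)]; rfl

/-- If `s` and `t` have opposite signs, `s - t` has the sign of `s`. -/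
theorem signBit_sub {s t : ℝ} (hs : s ≠ 0) (ht : t ≠ 0) (h : signBit s ≠ signBit t) :
    signBit (s - t) = signBit s := by
  unfold signBit at *
  rcases lt_or_gt_of_ne hs with h1 | h1 <;> rcases lt_or_gt_of_ne ht with h2 | h2
  · simp [h1, h2] at h
  · rw [if_pos (by linarith), if_pos h1]
  · rw [if_neg (by linarith), if_neg (by linarith)]
  · simp [h1.not_gt, h2.not_gt] at h

theorem det3_neg_left (a b c : Fin 3 → ℝ) : det3 (-a) b c = -det3 a b c := by
  simp [det3]; ring

theorem det3_neg_right (a b c : Fin 3 → ℝ) : det3 a b (-c) = -det3 a b c := by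
  simp [det3]; ring

theorem det3_swap (a b c : Fin 3 → ℝ) : det3 b a c = -det3 a b c := by
  simp only [det3]; ring

/-- The `aᵢ`, `bᵢ` stand for signs of coordinates of two points, and `x`, `y`, `z` for signs of the
minors. A difference of two products has a forced sign only when the products have opposite signs;
in the other cases the identity holds for either value. -/
theorem triangle_identity_bits : ∀ a₁ a₂ a₃ b₁ b₂ b₃ x y z : ZMod 2,
    (a₂ + b₃ ≠ a₃ + b₂ → x = a₂ + b₃) → (a₃ + b₁ ≠ a₁ + b₃ → y = a₃ + b₁) →
    (a₁ + b₂ ≠ a₂ + b₁ → z = a₁ + b₂) →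
    (x + y) * (a₃ + b₃) + (y + z) * (a₁ + b₁) + (z + x) * (a₂ + b₂) =
      (a₁ * a₂ * a₃ + (a₁ + 1) * (a₂ + 1) * (a₃ + 1)) +
      (b₁ * b₂ * b₃ + (b₁ + 1) * (b₂ + 1) * (b₃ + 1)) := by
  decide

theorem signBit_minor {p q r s : ℝ} (hp : p ≠ 0) (hq : q ≠ 0) (hr : r ≠ 0) (hs : s ≠ 0)
    (h : signBit p + signBit q ≠ signBit r + signBit s) :
    signBit (p * q - r * s) = signBit p + signBit q := by
  rw [signBit_sub (mul_ne_zero hp hq) (mul_ne_zero hr hs), signBit_mul hp hq]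
  rwa [signBit_mul hp hq, signBit_mul hr hs]

/-- A segment crosses the boundary of a triangle as often, modulo two, as it has endpoints in the
triangle. -/
theorem crossing_triangle {a b c d r : Fin 3 → ℝ} (h : det3 c d r ≠ 0)
    (ha₁ : det3 d r a ≠ 0) (ha₂ : det3 r c a ≠ 0) (ha₃ : det3 c d a ≠ 0)
    (hb₁ : det3 d r b ≠ 0) (hb₂ : det3 r c b ≠ 0) (hb₃ : det3 c d b ≠ 0)
    (hx : det3 a b c ≠ 0) (hy : det3 a b d ≠ 0) (hz : det3 a b r ≠ 0) :
    crossing a b c d + crossing a b d r + crossing a b r c =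
      inTriangle c d r a + inTriangle c d r b := by
  -- Up to the factor `det3 c d r`, these determinants are the minors of the coordinates of `a` and
  -- `b` in the basis `c, d, r`. The sign of that factor occurs twice in each sum and drops out
  -- modulo two.
  have ex : det3 c d r * det3 a b c = det3 r c a * det3 c d b - det3 c d a * det3 r c b := by
    simp only [det3]; ring
  have ey : det3 c d r * det3 a b d = det3 c d a * det3 d r b - det3 d r a * det3 c d b := by
    simp only [det3]; ring
  have ez : det3 c d r * det3 a b r = det3 d r a * det3 r c b - det3 r c a * det3 d r b := by
    simp only [det3]; ring
  have key := triangle_identity_bits _ _ _ _ _ _ _ _ _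
    (fun h => (congrArg signBit ex).trans (signBit_minor ha₂ hb₃ ha₃ hb₂ h))
    (fun h => (congrArg signBit ey).trans (signBit_minor ha₃ hb₁ ha₁ hb₃ h))
    (fun h => (congrArg signBit ez).trans (signBit_minor ha₁ hb₂ ha₂ hb₁ h))
  rw [signBit_mul h hx, signBit_mul h hy, signBit_mul h hz] at key
  unfold crossing inTriangle
  rw [← key]
  have two : (2 : ZMod 2) = 0 := rfl
  linear_combination (-(signBit (det3 c d r)) * (signBit (det3 c d a) + signBit (det3 c d b) +
    signBit (det3 d r a) + signBit (det3 d r b) + signBit (det3 r c a) + signBit (det3 r c b))) *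
    two

theorem inTriangle_neg {a c d r : Fin 3 → ℝ}
    (h₁ : det3 d r a ≠ 0) (h₂ : det3 r c a ≠ 0) (h₃ : det3 c d a ≠ 0) :
    inTriangle c d r (-a) = inTriangle c d r a := by
  unfold inTriangle
  rw [det3_neg_right, det3_neg_right, det3_neg_right, signBit_neg h₁, signBit_neg h₂,
    signBit_neg h₃]
  generalize signBit (det3 d r a) = x
  generalize signBit (det3 r c a) = y
  generalize signBit (det3 c d a) = z
  revert x y z
  decide

theorem crossing_comm_right {a b c d : Fin 3 → ℝ} (ha : det3 c d a ≠ 0) (hb : det3 c d b ≠ 0) :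
    crossing a b d c = crossing a b c d := by
  unfold crossing
  rw [det3_swap c d a, det3_swap c d b, signBit_neg ha, signBit_neg hb]
  have two : (2 : ZMod 2) = 0 := rfl
  linear_combination (signBit (det3 a b c) + signBit (det3 a b d)) * two

theorem sum_add_succ_eq (f : ℕ → ZMod 2) (n : ℕ) :
    ∑ i ∈ Finset.range n, (f i + f (i + 1)) = f 0 + f n := by
  have two : (2 : ZMod 2) = 0 := rfl
  induction n with
  | zero => simp; linear_combination (-f 0) * two
  | succ n ih => rw [Finset.sum_range_succ, ih]; linear_combination f n * two

/-- Two closed curves in the projective plane that both lift to paths between antipodal points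
cross an odd number of times. -/
theorem sum_crossing_eq_one {n m : ℕ} {u w : ℕ → Fin 3 → ℝ} {r : Fin 3 → ℝ}
    (hu : u n = -u 0) (hw : w m = -w 0)
    (h₁ : ∀ i < n, ∀ j ≤ m, det3 (u i) (u (i + 1)) (w j) ≠ 0)
    (h₂ : ∀ i < n, det3 (u i) (u (i + 1)) r ≠ 0)
    (h₃ : ∀ j < m, ∀ i ≤ n, det3 (w j) (w (j + 1)) (u i) ≠ 0)
    (h₄ : ∀ j < m, det3 (w j) (w (j + 1)) r ≠ 0)
    (h₅ : ∀ j ≤ m, ∀ i ≤ n, det3 (w j) r (u i) ≠ 0) :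
    ∑ j ∈ Finset.range m, ∑ i ∈ Finset.range n,
      crossing (u i) (u (i + 1)) (w j) (w (j + 1)) = 1 := by
  have two : (2 : ZMod 2) = 0 := rfl
  -- Each segment of `w` is coned off from the generic point `r`. The closed curve `u` crosses the
  -- boundary of each triangle an even number of times, so the sum over `w` telescopes to `F 0 + F
  -- m`.
  set F : ℕ → ZMod 2 := fun j => ∑ i ∈ Finset.range n, crossing (u i) (u (i + 1)) (w j) r with hF
  have h₅' : ∀ j ≤ m, ∀ i ≤ n, det3 r (w j) (u i) ≠ 0 := fun j hj i hi => by
    rw [det3_swap]; exact neg_ne_zero.2 (h₅ j hj i hi)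
  have step : ∀ j < m, ∑ i ∈ Finset.range n, crossing (u i) (u (i + 1)) (w j) (w (j + 1)) =
      F j + F (j + 1) := by
    intro j hj
    have hT : ∑ i ∈ Finset.range n, (inTriangle (w j) (w (j + 1)) r (u i) +
        inTriangle (w j) (w (j + 1)) r (u (i + 1))) = 0 := by
      rw [sum_add_succ_eq (fun i => inTriangle (w j) (w (j + 1)) r (u i)), hu,
        inTriangle_neg (h₅ _ hj _ (Nat.zero_le _)) (h₅' _ hj.le _ (Nat.zero_le _))
          (h₃ _ hj _ (Nat.zero_le _))]
      linear_combination inTriangle (w j) (w (j + 1)) r (u 0) * two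
    have hsum : ∑ i ∈ Finset.range n, crossing (u i) (u (i + 1)) (w j) (w (j + 1)) +
        F (j + 1) + F j = 0 := by
      rw [← hT, hF, ← Finset.sum_add_distrib, ← Finset.sum_add_distrib]
      refine Finset.sum_congr rfl fun i hi => ?_
      have hi := Finset.mem_range.1 hi
      rw [← crossing_triangle (h₄ j hj) (h₅ _ hj _ hi.le) (h₅' _ hj.le _ hi.le) (h₃ _ hj _ hi.le)
        (h₅ _ hj _ hi) (h₅' _ hj.le _ hi) (h₃ _ hj _ hi) (h₁ _ hi _ hj.le) (h₁ _ hi _ hj)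
        (h₂ _ hi), crossing_comm_right (h₅ _ hj.le _ hi.le) (h₅ _ hj.le _ hi)]
    linear_combination hsum - (F j + F (j + 1)) * two
  rw [Finset.sum_congr rfl fun j hj => step j (Finset.mem_range.1 hj), sum_add_succ_eq]
  -- Since `w m = -w 0`, the two remaining segments together form the whole projective line through
  -- `w 0` and `r`. Crossing it means changing sides of a plane, which happens an odd number of
  -- times between antipodal points.
  have hends : F 0 + F m = ∑ i ∈ Finset.range n,
      (signBit (det3 (w 0) r (u i)) + signBit (det3 (w 0) r (u (i + 1)))) := by
    rw [hF, ← Finset.sum_add_distrib]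
    refine Finset.sum_congr rfl fun i hi => ?_
    have hi := Finset.mem_range.1 hi
    simp only [crossing, hw, det3_neg_left, det3_neg_right]
    rw [signBit_neg (h₁ _ hi _ (Nat.zero_le _)), signBit_neg (h₅ _ (Nat.zero_le _) _ hi.le),
      signBit_neg (h₅ _ (Nat.zero_le _) _ hi)]
    generalize signBit (det3 (u i) (u (i + 1)) (w 0)) = x
    generalize signBit (det3 (u i) (u (i + 1)) r) = y
    generalize signBit (det3 (w 0) r (u i)) = z
    generalize signBit (det3 (w 0) r (u (i + 1))) = t
    revert x y z t
    decide
  rw [hends, sum_add_succ_eq (fun i => signBit (det3 (w 0) r (u i))), hu, det3_neg_right,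
    signBit_neg (h₅ _ (Nat.zero_le _) _ (Nat.zero_le _))]
  linear_combination signBit (det3 (w 0) r (u 0)) * two

/-- Two vectors of `ℝ³` are proportional in the sense that all their `2 × 2` minors vanish. -/
def Parallel (p q : Fin 3 → ℝ) : Prop := ∀ k l, p k * q l = p l * q k

/-- The witness `x` is the zero of the affine function with values `s` at 0 and `t` at 1. -/
theorem opposite_signs_of_signBit_add_ne_zero {s t : ℝ} (hs : s ≠ 0) (ht : t ≠ 0)
    (h : signBit s + signBit t ≠ 0) : ∃ x ∈ Set.Icc (0 : ℝ) 1, ∃ k : ℝ, k ≠ 0 ∧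
      1 - x = k * t ∧ x = -k * s := by
  have hne : t - s ≠ 0 := by
    intro h0
    rw [sub_eq_zero.1 h0] at h
    exact h (CharTwo.add_self_eq_zero _)
  have hk : 0 ≤ s / (s - t) ∧ s / (s - t) ≤ 1 := by
    unfold signBit at h
    rcases lt_or_gt_of_ne hs with h1 | h1 <;> rcases lt_or_gt_of_ne ht with h2 | h2
    · exact absurd (by rw [if_pos h1, if_pos h2]; rfl) h
    · exact ⟨div_nonneg_of_nonpos h1.le (by linarith),
        (div_le_one_of_neg (by linarith)).2 (by linarith)⟩
    · exact ⟨div_nonneg h1.le (by linarith), (div_le_one (by linarith)).2 (by linarith)⟩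
    · exact absurd (by rw [if_neg h1.not_gt, if_neg h2.not_gt]; rfl) h
  have hne' : s - t ≠ 0 := fun h0 => hne (by linarith)
  refine ⟨s / (s - t), hk, 1 / (t - s), one_div_ne_zero hne, ?_, ?_⟩
  · field_simp; ring
  · rw [← neg_sub s t]; field_simp

theorem exists_parallel_of_crossing_ne_zero {a b c d : Fin 3 → ℝ}
    (h₁ : det3 a b c ≠ 0) (h₂ : det3 a b d ≠ 0) (h₃ : det3 c d a ≠ 0) (h₄ : det3 c d b ≠ 0)
    (h : crossing a b c d ≠ 0) : ∃ s ∈ Set.Icc (0 : ℝ) 1, ∃ t ∈ Set.Icc (0 : ℝ) 1,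
      Parallel ((1 - s) • a + s • b) ((1 - t) • c + t • d) := by
  obtain ⟨s, hs, k, hk, hs1, hs2⟩ :=
    opposite_signs_of_signBit_add_ne_zero h₃ h₄ (right_ne_zero_of_mul h)
  obtain ⟨t, ht, l, hl, ht1, ht2⟩ :=
    opposite_signs_of_signBit_add_ne_zero h₁ h₂ (left_ne_zero_of_mul h)
  refine ⟨s, hs, t, ht, ?_⟩
  have hp : (1 - s) • a + s • b = k • (det3 c d b • a - det3 c d a • b) := by
    rw [hs1, hs2]; module
  have hq : (1 - t) • c + t • d = l • (det3 a b d • c - det3 a b c • d) := by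
    rw [ht1, ht2]; module
  -- The linear relation between four vectors of `ℝ³` gives a vector common to the plane of `a, b`
  -- and the plane of `c, d`.
  have hpq : det3 c d b • a - det3 c d a • b = -(det3 a b d • c - det3 a b c • d) := by
    ext i
    fin_cases i <;> simp [det3] <;> ring
  rw [hp, hq, hpq]
  intro i j
  simp only [Pi.smul_apply, Pi.neg_apply, smul_eq_mul]
  ring

end Crossings

/-! ### Reduction to general position. -/

section Perturbation

open Filter Topology

/-- A point of the moment curve. -/
def momentPoint (k : ℕ) : Fin 3 → ℝ := ![1, k, (k : ℝ) ^ 2]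

theorem det3_momentPoint_ne_zero {x y z : ℝ} (hx : x ≠ 0) (hy : y ≠ 0) (hz : z ≠ 0) {a b c : ℕ}
    (hab : a ≠ b) (hac : a ≠ c) (hbc : b ≠ c) :
    det3 (x • momentPoint a) (y • momentPoint b) (z • momentPoint c) ≠ 0 := by
  have h : det3 (x • momentPoint a) (y • momentPoint b) (z • momentPoint c) =
      x * y * z * (((b : ℝ) - a) * (c - a) * (c - b)) := by
    simp [det3, momentPoint]; ring
  rw [h]
  have h1 : (b : ℝ) - a ≠ 0 := sub_ne_zero.2 (Nat.cast_injective.ne hab.symm)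
  have h2 : (c : ℝ) - a ≠ 0 := sub_ne_zero.2 (Nat.cast_injective.ne hac.symm)
  have h3 : (c : ℝ) - b ≠ 0 := sub_ne_zero.2 (Nat.cast_injective.ne hbc.symm)
  positivity

/-- The determinant is a cubic polynomial in `ε` with leading coefficient `det3 g h k`, so it has
finitely many zeros. -/
theorem eventually_det3_ne_zero (p q r : Fin 3 → ℝ) {g h k : Fin 3 → ℝ} (hd : det3 g h k ≠ 0) :
    ∀ᶠ ε in 𝓝[≠] (0 : ℝ), det3 (p + ε • g) (q + ε • h) (r + ε • k) ≠ 0 := by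
  let P : Polynomial ℝ := Polynomial.C (det3 p q r) +
    Polynomial.C (det3 g q r + det3 p h r + det3 p q k) * Polynomial.X +
    Polynomial.C (det3 g h r + det3 g q k + det3 p h k) * Polynomial.X ^ 2 +
    Polynomial.C (det3 g h k) * Polynomial.X ^ 3
  have hP : P ≠ 0 := by
    intro h0
    have : P.coeff 3 = 0 := by rw [h0, Polynomial.coeff_zero]
    simp only [P, Polynomial.coeff_add, Polynomial.coeff_C_mul, Polynomial.coeff_C,
      Polynomial.coeff_X, Polynomial.coeff_X_pow] at this
    norm_num at this
    exact hd this
  have heval : ∀ ε, P.eval ε = det3 (p + ε • g) (q + ε • h) (r + ε • k) := by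
    intro ε
    simp [P, det3]
    ring
  have hfin : {ε : ℝ | ¬ det3 (p + ε • g) (q + ε • h) (r + ε • k) ≠ 0}.Finite := by
    refine (Polynomial.finite_setOfPred_isRoot hP).subset fun ε hε => ?_
    rw [Set.mem_ofPred_eq, not_not] at hε
    rw [Set.mem_ofPred_eq, Polynomial.IsRoot.def, heval, hε]
  exact nhdsNE_le_cofinite _ (eventually_cofinite.2 hfin)

/-- Being non-parallel is an open condition, and `(s, t)` ranges over a compact square. -/
theorem eventually_not_parallel (a b c d a' b' c' d' : Fin 3 → ℝ)
    (h : ∀ s ∈ Set.Icc (0 : ℝ) 1, ∀ t ∈ Set.Icc (0 : ℝ) 1,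
      ¬ Parallel ((1 - s) • a + s • b) ((1 - t) • c + t • d)) :
    ∀ᶠ ε in 𝓝 (0 : ℝ), ∀ s ∈ Set.Icc (0 : ℝ) 1, ∀ t ∈ Set.Icc (0 : ℝ) 1,
      ¬ Parallel ((1 - s) • (a + ε • a') + s • (b + ε • b'))
        ((1 - t) • (c + ε • c') + t • (d + ε • d')) := by
  have hK : IsCompact (Set.Icc (0 : ℝ) 1 ×ˢ Set.Icc (0 : ℝ) 1) := isCompact_Icc.prod isCompact_Icc
  have := hK.eventually_forall_of_forall_eventually (x₀ := (0 : ℝ))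
    (P := fun ε x => ¬ Parallel ((1 - x.1) • (a + ε • a') + x.1 • (b + ε • b'))
        ((1 - x.2) • (c + ε • c') + x.2 • (d + ε • d'))) ?_
  · filter_upwards [this] with ε hε s hs t ht
    exact hε (s, t) ⟨hs, ht⟩
  · rintro ⟨s, t⟩ ⟨hs, ht⟩
    have hst := h s hs t ht
    unfold Parallel at hst
    push Not at hst
    obtain ⟨k, l, hkl⟩ := hst
    have hcont : ∀ f g : ℝ × ℝ × ℝ → ℝ, Continuous f → Continuous g →
        f (0, s, t) ≠ g (0, s, t) → ∀ᶠ z in 𝓝 ((0 : ℝ), s, t), f z ≠ g z := fun f g hf hg hne =>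
      (isOpen_ne_fun hf hg).mem_nhds hne
    have := hcont
      (fun z => ((1 - z.2.1) * (a k + z.1 * a' k) + z.2.1 * (b k + z.1 * b' k)) *
        ((1 - z.2.2) * (c l + z.1 * c' l) + z.2.2 * (d l + z.1 * d' l)))
      (fun z => ((1 - z.2.1) * (a l + z.1 * a' l) + z.2.1 * (b l + z.1 * b' l)) *
        ((1 - z.2.2) * (c k + z.1 * c' k) + z.2.2 * (d k + z.1 * d' k)))
      (by fun_prop) (by fun_prop) (by simpa using hkl)
    filter_upwards [this] with z hz hpar
    exact hz (hpar k l)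

/-- Two closed polygons in the projective plane that both lift to paths between antipodal points
have a common point. -/
theorem exists_parallel {n m : ℕ} (hn : 2 ≤ n) (hm : 2 ≤ m) {u w : ℕ → Fin 3 → ℝ}
    (hu : u n = -u 0) (hw : w m = -w 0) :
    ∃ i < n, ∃ j < m, ∃ s ∈ Set.Icc (0 : ℝ) 1, ∃ t ∈ Set.Icc (0 : ℝ) 1,
      Parallel ((1 - s) • u i + s • u (i + 1)) ((1 - t) • w j + t • w (j + 1)) := by
  by_contra! hno
  -- The perturbations keep the endpoints antipodal (`g n = -g 0`, `h m = -h 0`). Vertices of `u`,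
  -- vertices of `w` and `r` use the disjoint moment-curve parameters `0, …, n - 1`, then `n, …, n +
  -- m - 1`, then `n + m`.
  let g : ℕ → Fin 3 → ℝ := fun i => (if i < n then (1 : ℝ) else -1) • momentPoint (i % n)
  let h : ℕ → Fin 3 → ℝ := fun j => (if j < m then (1 : ℝ) else -1) • momentPoint (n + j % m)
  let k : Fin 3 → ℝ := (1 : ℝ) • momentPoint (n + m)
  have hsgn : ∀ i l : ℕ, (if i < l then (1 : ℝ) else -1) ≠ 0 := by
    intro i l; split_ifs <;> norm_num
  have hmod : ∀ l, 2 ≤ l → ∀ i, i % l ≠ (i + 1) % l := by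
    intro l hl i hi
    rw [← Nat.mod_add_mod] at hi
    have := Nat.mod_lt i (by omega : 0 < l)
    rcases (Nat.succ_le_of_lt this).lt_or_eq with hlt | heq
    · rw [Nat.mod_eq_of_lt hlt] at hi
      omega
    · rw [← Nat.succ_eq_add_one (i % l), heq, Nat.mod_self] at hi
      omega
  have hun : ∀ i, i % n < n := fun i => Nat.mod_lt i (by omega)
  have hwm : ∀ j, j % m < m := fun j => Nat.mod_lt j (by omega)
  have e₁ : ∀ᶠ ε in 𝓝[≠] (0 : ℝ), ∀ i ∈ {i | i < n}, ∀ j ∈ {j | j ≤ m},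
      det3 (u i + ε • g i) (u (i + 1) + ε • g (i + 1)) (w j + ε • h j) ≠ 0 := by
    refine (eventually_all_finite (Set.finite_lt_nat n)).2 fun i _ =>
      (eventually_all_finite (Set.finite_le_nat m)).2 fun j _ => eventually_det3_ne_zero _ _ _ ?_
    have := hun i; have := hun (i + 1)
    exact det3_momentPoint_ne_zero (hsgn _ _) (hsgn _ _) (hsgn _ _) (hmod n hn i) (by omega)
      (by omega)
  have e₂ : ∀ᶠ ε in 𝓝[≠] (0 : ℝ), ∀ i ∈ {i | i < n},
      det3 (u i + ε • g i) (u (i + 1) + ε • g (i + 1)) (0 + ε • k) ≠ 0 := by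
    refine (eventually_all_finite (Set.finite_lt_nat n)).2 fun i _ =>
      eventually_det3_ne_zero _ _ _ ?_
    have := hun i; have := hun (i + 1)
    exact det3_momentPoint_ne_zero (hsgn _ _) (hsgn _ _) one_ne_zero (hmod n hn i) (by omega)
      (by omega)
  have e₃ : ∀ᶠ ε in 𝓝[≠] (0 : ℝ), ∀ j ∈ {j | j < m}, ∀ i ∈ {i | i ≤ n},
      det3 (w j + ε • h j) (w (j + 1) + ε • h (j + 1)) (u i + ε • g i) ≠ 0 := by
    refine (eventually_all_finite (Set.finite_lt_nat m)).2 fun j _ =>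
      (eventually_all_finite (Set.finite_le_nat n)).2 fun i _ => eventually_det3_ne_zero _ _ _ ?_
    have := hun i; have := hmod m hm j
    exact det3_momentPoint_ne_zero (hsgn _ _) (hsgn _ _) (hsgn _ _) (by omega) (by omega)
      (by omega)
  have e₄ : ∀ᶠ ε in 𝓝[≠] (0 : ℝ), ∀ j ∈ {j | j < m},
      det3 (w j + ε • h j) (w (j + 1) + ε • h (j + 1)) (0 + ε • k) ≠ 0 := by
    refine (eventually_all_finite (Set.finite_lt_nat m)).2 fun j _ =>
      eventually_det3_ne_zero _ _ _ ?_
    have := hwm j; have := hwm (j + 1); have := hmod m hm j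
    exact det3_momentPoint_ne_zero (hsgn _ _) (hsgn _ _) one_ne_zero (by omega) (by omega)
      (by omega)
  have e₅ : ∀ᶠ ε in 𝓝[≠] (0 : ℝ), ∀ j ∈ {j | j ≤ m}, ∀ i ∈ {i | i ≤ n},
      det3 (w j + ε • h j) (0 + ε • k) (u i + ε • g i) ≠ 0 := by
    refine (eventually_all_finite (Set.finite_le_nat m)).2 fun j _ =>
      (eventually_all_finite (Set.finite_le_nat n)).2 fun i _ => eventually_det3_ne_zero _ _ _ ?_
    have := hun i; have := hwm j
    exact det3_momentPoint_ne_zero (hsgn _ _) one_ne_zero (hsgn _ _) (by omega) (by omega)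
      (by omega)
  have e₆ : ∀ᶠ ε in 𝓝[≠] (0 : ℝ), ∀ i ∈ {i | i < n}, ∀ j ∈ {j | j < m},
      ∀ s ∈ Set.Icc (0 : ℝ) 1, ∀ t ∈ Set.Icc (0 : ℝ) 1,
      ¬ Parallel ((1 - s) • (u i + ε • g i) + s • (u (i + 1) + ε • g (i + 1)))
        ((1 - t) • (w j + ε • h j) + t • (w (j + 1) + ε • h (j + 1))) := by
    refine (eventually_all_finite (Set.finite_lt_nat n)).2 fun i hi =>
      (eventually_all_finite (Set.finite_lt_nat m)).2 fun j hj => ?_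
    exact (eventually_not_parallel _ _ _ _ _ _ _ _ (hno i hi j hj)).filter_mono nhdsWithin_le_nhds
  obtain ⟨ε, h₁, h₂, h₃, h₄, h₅, h₆⟩ := (e₁.and (e₂.and (e₃.and (e₄.and (e₅.and e₆))))).exists
  have hsum := sum_crossing_eq_one (u := fun i => u i + ε • g i) (w := fun j => w j + ε • h j)
    (r := 0 + ε • k) (n := n) (m := m)
    (by simp [g, hu, show 0 < n by omega, add_comm]) (by simp [h, hw, show 0 < m by omega, add_comm])
    h₁ h₂ h₃ h₄ h₅
  obtain ⟨j, hj, hj0⟩ := Finset.exists_ne_zero_of_sum_ne_zero (hsum.trans_ne one_ne_zero)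
  obtain ⟨i, hi, hi0⟩ := Finset.exists_ne_zero_of_sum_ne_zero hj0
  have hi := Finset.mem_range.1 hi
  have hj := Finset.mem_range.1 hj
  obtain ⟨s, hs, t, ht, hst⟩ := exists_parallel_of_crossing_ne_zero (h₁ i hi j hj.le)
    (h₁ i hi (j + 1) hj) (h₃ j hj i hi.le) (h₃ j hj (i + 1) hi) hi0
  exact h₆ i hi j hj s hs t ht hst

end Perturbation

/-! ### Metric inequalities for arcs of diameters. -/

section Diameters

open scoped RealInnerProductSpace

variable {E : Type*} [NormedAddCommGroup E] [InnerProductSpace ℝ E]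

theorem norm_sub_sq_le_two_inner {D : ℝ} {x a z : E} (hax : dist a x = D) (haz : dist a z ≤ D) :
    ‖z - x‖ ^ 2 ≤ 2 * ⟪a - x, z - x⟫ := by
  have h1 : ‖a - z‖ ^ 2 = ‖a - x‖ ^ 2 - 2 * ⟪a - x, z - x⟫ + ‖z - x‖ ^ 2 := by
    rw [← norm_sub_sq_real]; congr 2; abel
  rw [dist_eq_norm] at hax haz
  have h2 : ‖a - z‖ ^ 2 ≤ D ^ 2 := by gcongr
  rw [hax] at h1
  linarith

theorem norm_sub_sq_le_two_inner_combo {D : ℝ} {x a₁ a₂ z : E} (h₁ : dist a₁ x = D)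
    (h₂ : dist a₂ x = D) (hz₁ : dist a₁ z ≤ D) (hz₂ : dist a₂ z ≤ D) {s₁ s₂ : ℝ} (hs₁ : 0 ≤ s₁)
    (hs₂ : 0 ≤ s₂) :
    (s₁ + s₂) * ‖z - x‖ ^ 2 ≤ 2 * ⟪s₁ • (a₁ - x) + s₂ • (a₂ - x), z - x⟫ := by
  have k₁ := mul_le_mul_of_nonneg_left (norm_sub_sq_le_two_inner h₁ hz₁) hs₁
  have k₂ := mul_le_mul_of_nonneg_left (norm_sub_sq_le_two_inner h₂ hz₂) hs₂
  rw [inner_add_left, real_inner_smul_left, real_inner_smul_left]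
  linarith

/-- The point of the arc from `a₁` to `a₂` around `x` lies in every ball of radius `D` that
contains `x`, `a₁` and `a₂`. -/
theorem norm_arc_sub_le {D : ℝ} (hD : 0 ≤ D) {x a₁ a₂ z e : E} (h₁ : dist a₁ x = D)
    (h₂ : dist a₂ x = D) (hz₁ : dist a₁ z ≤ D) (hz₂ : dist a₂ z ≤ D) {s₁ s₂ : ℝ}
    (hs₁ : 0 ≤ s₁) (hs₂ : 0 ≤ s₂) (hs : 1 ≤ s₁ + s₂)
    (he : e = s₁ • (a₁ - x) + s₂ • (a₂ - x)) (hn : ‖e‖ = D) : ‖x + e - z‖ ≤ D := by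
  have h := norm_sub_sq_le_two_inner_combo h₁ h₂ hz₁ hz₂ hs₁ hs₂
  rw [← he] at h
  have h3 : ‖x + e - z‖ ^ 2 = ‖e‖ ^ 2 - 2 * ⟪e, z - x⟫ + ‖z - x‖ ^ 2 := by
    rw [← norm_sub_sq_real]; congr 2; abel
  have h4 : ‖x + e - z‖ ^ 2 ≤ D ^ 2 := by
    rw [hn] at h3
    nlinarith [sq_nonneg ‖z - x‖]
  exact le_of_sq_le_sq h4 hD

theorem norm_convex_combo_sq {D : ℝ} {a b : E} (ha : ‖a‖ = D) (hb : ‖b‖ = D) (s : ℝ) :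
    ‖(1 - s) • a + s • b‖ ^ 2 = D ^ 2 - s * (1 - s) * ‖a - b‖ ^ 2 := by
  rw [norm_add_sq_real, norm_sub_sq_real, norm_smul, norm_smul, mul_pow, mul_pow, ha, hb,
    real_inner_smul_left, real_inner_smul_right, Real.norm_eq_abs, Real.norm_eq_abs, sq_abs,
    sq_abs]
  ring

theorem norm_convex_combo_le {D : ℝ} (hD : 0 ≤ D) {a b : E} (ha : ‖a‖ = D) (hb : ‖b‖ = D) {s : ℝ}
    (hs : s ∈ Set.Icc (0 : ℝ) 1) : ‖(1 - s) • a + s • b‖ ≤ D := by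
  refine le_of_sq_le_sq ?_ hD
  rw [norm_convex_combo_sq ha hb]
  have := mul_nonneg (mul_nonneg hs.1 (sub_nonneg.2 hs.2)) (sq_nonneg ‖a - b‖)
  linarith

/-- The arcs formed by the diameters at two points `x`, `y` point neither in a common direction nor
in opposite directions, unless `x` and `y` are joined by one of these diameters. -/
theorem smul_ne_of_diameters {D : ℝ} (hD : 0 < D) {x a₁ a₂ y b₁ b₂ : E} (hxy : x ≠ y)
    (hya₁ : y ≠ a₁) (hya₂ : y ≠ a₂) (hxb₁ : x ≠ b₁)
    (ha₁ : dist a₁ x = D) (ha₂ : dist a₂ x = D) (hb₁ : dist b₁ y = D) (hb₂ : dist b₂ y = D)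
    (dxy : dist x y ≤ D) (da₁y : dist a₁ y ≤ D) (da₂y : dist a₂ y ≤ D) (db₁x : dist b₁ x ≤ D)
    (db₂x : dist b₂ x ≤ D) (d₁₁ : dist a₁ b₁ ≤ D) (d₁₂ : dist a₁ b₂ ≤ D) (d₂₁ : dist a₂ b₁ ≤ D)
    (d₂₂ : dist a₂ b₂ ≤ D) {s t : ℝ} (hs : s ∈ Set.Icc (0 : ℝ) 1) (ht : t ∈ Set.Icc (0 : ℝ) 1)
    {p q : E} (hp : p = (1 - s) • (a₁ - x) + s • (a₂ - x))
    (hq : q = (1 - t) • (b₁ - y) + t • (b₂ - y)) (c : ℝ) : p ≠ c • q := by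
  intro hpq
  -- The vector `p` points from `x` towards the side of `y`, and `q` from `y` towards the side of
  -- `x`, so `c` must be negative.
  have hpos : 0 < ‖y - x‖ := norm_pos_iff.2 (sub_ne_zero.2 hxy.symm)
  have hpy : 0 < ⟪p, y - x⟫ := by
    have := norm_sub_sq_le_two_inner_combo ha₁ ha₂ da₁y da₂y (sub_nonneg.2 hs.2) hs.1
    rw [← hp] at this
    nlinarith
  have hqy : ⟪q, y - x⟫ < 0 := by
    have := norm_sub_sq_le_two_inner_combo hb₁ hb₂ db₁x db₂x (sub_nonneg.2 ht.2) ht.1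
    rw [← hq, norm_sub_rev, ← neg_sub y x, inner_neg_right] at this
    nlinarith
  have hc : c < 0 := by
    rw [hpq, real_inner_smul_left] at hpy
    by_contra h
    nlinarith
  have hp0 : 0 < ‖p‖ := norm_pos_iff.2 fun h => by simp [h] at hpy
  have hq0 : 0 < ‖q‖ := norm_pos_iff.2 fun h => by simp [h] at hqy
  have na₁ : ‖a₁ - x‖ = D := by rw [← dist_eq_norm, ha₁]
  have na₂ : ‖a₂ - x‖ = D := by rw [← dist_eq_norm, ha₂]
  have hpD : ‖p‖ ≤ D := hp ▸ norm_convex_combo_le hD.le na₁ na₂ hs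
  have hqD : ‖q‖ ≤ D := hq ▸ norm_convex_combo_le hD.le (by rw [← dist_eq_norm, hb₁])
    (by rw [← dist_eq_norm, hb₂]) ht
  set σ := D / ‖p‖ with hσ
  set τ := D / ‖q‖ with hτ
  have hσ1 : 1 ≤ σ := (one_le_div hp0).2 hpD
  have hτ1 : 1 ≤ τ := (one_le_div hq0).2 hqD
  have hσ0 : 0 ≤ σ := by linarith
  have hτ0 : 0 ≤ τ := by linarith
  -- Both directions are rescaled to length `D`, giving the arc points `x + e` and `y - e`.
  obtain ⟨e, he⟩ : ∃ e, e = σ • p := ⟨_, rfl⟩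
  have hen : ‖e‖ = D := by
    rw [he, norm_smul, Real.norm_of_nonneg hσ0, hσ, div_mul_cancel₀ _ hp0.ne']
  have heq : -e = τ • q := by
    have : ‖p‖ = -c * ‖q‖ := by
      rw [hpq, norm_smul, Real.norm_of_nonpos hc.le]
    have hcne : c ≠ 0 := hc.ne
    rw [he, hpq, smul_smul, ← neg_smul, hσ, this, hτ]
    congr 1
    field_simp
  have he' : e = (σ * (1 - s)) • (a₁ - x) + (σ * s) • (a₂ - x) := by
    rw [he, hp, smul_add, smul_smul, smul_smul]
  have hf' : -e = (τ * (1 - t)) • (b₁ - y) + (τ * t) • (b₂ - y) := by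
    rw [heq, hq, smul_add, smul_smul, smul_smul]
  have hσs : 0 ≤ σ * (1 - s) := mul_nonneg hσ0 (sub_nonneg.2 hs.2)
  have hσs' : 0 ≤ σ * s := mul_nonneg hσ0 hs.1
  have hτt : 0 ≤ τ * (1 - t) := mul_nonneg hτ0 (sub_nonneg.2 ht.2)
  have hτt' : 0 ≤ τ * t := mul_nonneg hτ0 ht.1
  have hP : ∀ z, dist a₁ z ≤ D → dist a₂ z ≤ D → ‖x + e - z‖ ≤ D := fun z h₁ h₂ =>
    norm_arc_sub_le hD.le ha₁ ha₂ h₁ h₂ hσs hσs' (by linarith) he' hen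
  have hfar : ‖y + -e - (x + e)‖ ≤ D :=
    norm_arc_sub_le hD.le hb₁ hb₂ (by rw [dist_comm, dist_eq_norm]; exact hP b₁ d₁₁ d₂₁)
      (by rw [dist_comm, dist_eq_norm]; exact hP b₂ d₁₂ d₂₂) hτt hτt' (by linarith) hf'
      (by rw [norm_neg, hen])
  -- Both `y - x` and `y - x - 2e` have norm at most `D = ‖e‖`; the parallelogram law then forces
  -- their midpoint `y - x - e` to vanish.
  have hy : y = x + e := by
    have hpar := parallelogram_law_with_norm ℝ (y - x - e) e
    have e1 : y - x - e + e = y - x := by abel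
    have e2 : y - x - e - e = y + -e - (x + e) := by abel
    rw [e1, e2, hen] at hpar
    have h1 : ‖y - x‖ ≤ D := by rwa [← dist_eq_norm, dist_comm]
    have h2 : ‖y - x - e‖ * ‖y - x - e‖ ≤ 0 := by
      nlinarith [norm_nonneg (y - x), norm_nonneg (y + -e - (x + e))]
    have h3 : ‖y - x - e‖ = 0 := mul_self_eq_zero.1 (le_antisymm h2 (mul_self_nonneg _))
    rw [norm_eq_zero] at h3
    rw [← sub_eq_zero, ← h3]; abel
  -- As `b₁` is equidistant from `x` and from `y = x + e` up to the law of cosines, `‖b₁ - x‖² =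
  -- 2⟪e, b₁ - x⟫`, while the cone inequality bounds this below by `σ ‖b₁ - x‖²`. With `σ = 1`, `p`
  -- has full length `D`, so it is an endpoint of its chord and `y` is `a₁` or `a₂`.
  have hσle : σ ≤ 1 := by
    have h := norm_sub_sq_le_two_inner_combo ha₁ ha₂ d₁₁ d₂₁ hσs hσs'
    rw [← he'] at h
    have h1 : ‖b₁ - y‖ ^ 2 = ‖b₁ - x‖ ^ 2 - 2 * ⟪b₁ - x, e⟫ + ‖e‖ ^ 2 := by
      rw [← norm_sub_sq_real, hy]; congr 2; abel
    rw [← dist_eq_norm, hb₁, hen, real_inner_comm] at h1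
    have h2 : 0 < ‖b₁ - x‖ ^ 2 := pow_pos (norm_pos_iff.2 (sub_ne_zero.2 hxb₁.symm)) 2
    by_contra hlt
    nlinarith
  have hσ' : σ = 1 := le_antisymm hσle hσ1
  have hyp : y - x = p := by rw [hy, he, hσ', one_smul]; abel
  have hcombo := norm_convex_combo_sq na₁ na₂ s
  have hpn : ‖p‖ = D := by rw [← hen, he, hσ', one_smul]
  rw [← hp, hpn] at hcombo
  have hzero : s * (1 - s) * ‖a₁ - x - (a₂ - x)‖ ^ 2 = 0 := by linarith
  rcases mul_eq_zero.1 hzero with h | h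
  · rcases mul_eq_zero.1 h with h | h
    · apply hya₁
      rw [h, sub_zero, one_smul, zero_smul, add_zero, ← hyp] at hp
      exact sub_left_injective hp
    · apply hya₂
      have : s = 1 := by linarith
      rw [this, sub_self, one_smul, zero_smul, zero_add, ← hyp] at hp
      exact sub_left_injective hp
  · apply hya₁
    rw [sq_eq_zero_iff, norm_eq_zero, sub_eq_zero] at h
    rw [← h, ← add_smul, sub_add_cancel, one_smul, ← hyp] at hp
    exact sub_left_injective hp

end Diameters

/-! ### Odd closed walks of diameters and the final deductions. -/

theorem Parallel.exists_eq_smul {p q : EuclideanSpace ℝ (Fin 3)} (h : Parallel p.ofLp q.ofLp)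
    (hq : q ≠ 0) : ∃ c : ℝ, p = c • q := by
  obtain ⟨l, hl⟩ : ∃ l, q l ≠ 0 := by
    by_contra! h0
    exact hq (by ext l; simpa using h0 l)
  refine ⟨p l / q l, ?_⟩
  ext k
  have := h k l
  simp only [PiLp.smul_apply, smul_eq_mul]
  field_simp
  exact this

/-- Two odd closed walks of diameters have a common point. -/
theorem exists_common_vertex_of_odd_diameter_walks {D : ℝ} (hD : 0 < D) {n m : ℕ} (hn : Odd n)
    (hm : Odd m) {c c' : ℕ → EuclideanSpace ℝ (Fin 3)} (hc : ∀ i, dist (c i) (c (i + 1)) = D)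
    (hc' : ∀ j, dist (c' j) (c' (j + 1)) = D) (hcn : ∀ i, c (i + n) = c i)
    (hcm : ∀ j, c' (j + m) = c' j) (hle : ∀ i j, dist (c i) (c' j) ≤ D) :
    ∃ i j, c i = c' j := by
  by_contra! hne
  have key : ∀ {n : ℕ} {c : ℕ → EuclideanSpace ℝ (Fin 3)}, Odd n →
      (∀ i, dist (c i) (c (i + 1)) = D) → (∀ i, c (i + n) = c i) → 2 ≤ n ∧
      ((-1 : ℝ) ^ n • (c (n + 1) - c n)).ofLp = -((-1 : ℝ) ^ 0 • (c (0 + 1) - c 0)).ofLp := by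
    intro n c hn hc hcn
    constructor
    · rcases hn with ⟨k, rfl⟩
      rcases k with _ | k
      · have := hc 0
        rw [show c (0 + 1) = c 0 from hcn 0, dist_self] at this
        exact absurd this hD.ne
      · omega
    · have h0 := hcn 0
      have h1 := hcn 1
      rw [zero_add] at h0
      rw [add_comm] at h1
      rw [hn.neg_one_pow, h0, h1]
      ext k
      simp
  obtain ⟨hn2, hu⟩ := key hn hc hcn
  obtain ⟨hm2, hw⟩ := key hm hc' hcm
  obtain ⟨i, -, j, -, s, hs, t, ht, hpar⟩ := exists_parallel hn2 hm2
    (u := fun i => ((-1 : ℝ) ^ i • (c (i + 1) - c i)).ofLp)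
    (w := fun j => ((-1 : ℝ) ^ j • (c' (j + 1) - c' j)).ofLp) hu hw
  -- The alternating signs turn each segment of the curve, up to sign, into a chord between the two
  -- diameters at the middle vertex `c (i + 1)`.
  have arc : ∀ (c : ℕ → EuclideanSpace ℝ (Fin 3)) (i : ℕ) (s : ℝ),
      (1 - s) • ((-1 : ℝ) ^ i • (c (i + 1) - c i)).ofLp +
        s • ((-1 : ℝ) ^ (i + 1) • (c (i + 1 + 1) - c (i + 1))).ofLp =
      ((-1 : ℝ) ^ (i + 1) •
        ((1 - s) • (c i - c (i + 1)) + s • (c (i + 2) - c (i + 1)))).ofLp := by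
    intro c i s
    ext k
    simp [pow_succ]
    ring
  simp only [arc] at hpar
  set p := (1 - s) • (c i - c (i + 1)) + s • (c (i + 2) - c (i + 1)) with hp
  set q := (1 - t) • (c' j - c' (j + 1)) + t • (c' (j + 2) - c' (j + 1)) with hq
  have hle' : ∀ j i, dist (c' j) (c i) ≤ D := fun j i => dist_comm (c i) (c' j) ▸ hle i j
  have hpq : ∀ a : ℝ, p ≠ a • q := smul_ne_of_diameters hD (hne _ _) (hne _ _).symm (hne _ _).symm
    (hne _ _) (hc i) ((dist_comm _ _).trans (hc (i + 1))) (hc' j)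
    ((dist_comm _ _).trans (hc' (j + 1))) (hle _ _) (hle _ _) (hle _ _) (hle' _ _) (hle' _ _)
    (hle _ _) (hle _ _) (hle _ _) (hle _ _) hs ht hp hq
  -- The reversed roles are needed to exclude `q = 0`, without which the vanishing minors would not
  -- give a scalar.
  have hqp : ∀ a : ℝ, q ≠ a • p := smul_ne_of_diameters hD (hne _ _).symm (hne _ _) (hne _ _)
    (hne _ _).symm (hc' j) ((dist_comm _ _).trans (hc' (j + 1))) (hc i)
    ((dist_comm _ _).trans (hc (i + 1))) (hle' _ _) (hle' _ _) (hle' _ _) (hle _ _) (hle _ _)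
    (hle' _ _) (hle' _ _) (hle' _ _) (hle' _ _) ht hs hq hp
  have hq0 : q ≠ 0 := by simpa using hqp 0
  obtain ⟨a, ha⟩ := hpar.exists_eq_smul
    (smul_ne_zero (pow_ne_zero _ (neg_ne_zero.2 one_ne_zero)) hq0)
  refine hpq ((-1 : ℝ) ^ (i + 1) * (a * (-1 : ℝ) ^ (j + 1))) ?_
  rw [← smul_smul, ← smul_smul, ← ha, smul_smul, ← mul_pow]
  simp

/-- The vertex set of a diameter graph in `ℝ³` cannot be split into two sets that both fail to be
2-colourable. -/
theorem twoColorableOn_or_compl {X : Set (EuclideanSpace ℝ (Fin 3))} [Fintype X] [DecidableEq X]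
    (S : Finset X) :
    TwoColorableOn (diameterGraph X) S ∨ TwoColorableOn (diameterGraph X) Sᶜ := by
  by_contra! h
  obtain ⟨n, c, hn, hcS, hc, hcn⟩ := exists_odd_closed_walk h.1
  obtain ⟨m, c', hm, hcS', hc', hcm⟩ := exists_odd_closed_walk h.2
  have hgreat : IsGreatest (distanceValues X) (dist (c 0 : EuclideanSpace ℝ (Fin 3)) (c (0 + 1))) :=
    hc 0
  set D := dist (c 0 : EuclideanSpace ℝ (Fin 3)) (c (0 + 1)) with hDdef
  have hD : 0 < D := dist_pos.2 fun h => (hc 0).ne (Subtype.ext h)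
  have hadj : ∀ {x y : X}, (diameterGraph X).Adj x y →
      dist (x : EuclideanSpace ℝ (Fin 3)) y = D := fun h => IsGreatest.unique h hgreat
  have hle : ∀ x y : X, dist (x : EuclideanSpace ℝ (Fin 3)) y ≤ D := by
    intro x y
    by_cases hxy : x = y
    · rw [hxy, dist_self]; exact hD.le
    · exact hgreat.2 ⟨x, x.2, y, y.2, fun h => hxy (Subtype.ext h), rfl⟩
  obtain ⟨i, j, hij⟩ := exists_common_vertex_of_odd_diameter_walks hD hn hm
    (c := fun i => c i) (c' := fun j => c' j) (fun i => hadj (hc i)) (fun j => hadj (hc' j))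
    (fun i => by rw [hcn]) (fun j => by rw [hcm]) (fun i j => hle _ _)
  have hij : c i = c' j := Subtype.ext hij
  exact Finset.mem_compl.1 (hcS' j) (hij ▸ hcS i)

/-- The diameter graph of 20 points in `ℝ³` has eight independent vertices. -/
theorem exists_indep_eight {X : Set (EuclideanSpace ℝ (Fin 3))} (hX : X.encard = 20) :
    ∃ I : Finset X, I.card = 8 ∧ ∀ x ∈ I, ∀ y ∈ I, ¬ (diameterGraph X).Adj x y := by
  classical
  have hfin : X.Finite := Set.finite_of_encard_eq_coe (k := 20) hX
  have := hfin.fintype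
  have hcard : Fintype.card X = 20 := by
    rw [← Set.coe_fintypeCard] at hX
    exact_mod_cast hX
  obtain ⟨I, -, hI, h8⟩ := hasIndep_eight hcard fun S => by
    convert twoColorableOn_or_compl S
  obtain ⟨J, hJ, hJ8⟩ := Finset.exists_subset_card_eq h8
  exact ⟨J, hJ8, fun x hx y hy => hI x (hJ hx) y (hJ hy)⟩

theorem theorem1p3 :
    (∀ X : Set (EuclideanSpace ℝ (Fin 3)), IsDistanceSet 5 X → 20 ≤ X.encard →
      ∃ s : ℕ, s ≤ 4 ∧ ∃ Y : Set (EuclideanSpace ℝ (Fin 3)),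
        Y ⊆ X ∧ Y.encard = 8 ∧ IsDistanceSet s Y) ∧
    (∀ X : Set (EuclideanSpace ℝ (Fin 3)), X.encard = 20 →
      8 ≤ (diameterGraph X).indepNum) := by
  refine ⟨fun X hX hcard => ?_, fun X hX => ?_⟩
  -- The largest distance `D` is taken in a 20-point subset `Z`; since it is also a distance of `X`,
  -- removing it leaves at most four.
  · obtain ⟨Z, hZX, hZ⟩ := Set.exists_subset_encard_eq hcard
    obtain ⟨I, hI8, hI⟩ := exists_indep_eight hZ
    have hZfin : Z.Finite := Set.finite_of_encard_eq_coe (k := 20) hZ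
    have mono : ∀ {A B : Set (EuclideanSpace ℝ (Fin 3))}, A ⊆ B →
        distanceValues A ⊆ distanceValues B := by
      rintro A B hAB r ⟨x, hx, y, hy, hxy⟩
      exact ⟨x, hAB hx, y, hAB hy, hxy⟩
    set Y : Set (EuclideanSpace ℝ (Fin 3)) := (↑) '' (I : Set Z) with hY
    have hYZ : Y ⊆ Z := by rintro _ ⟨y, -, rfl⟩; exact y.2
    have hXfin : (distanceValues X).Finite := Set.finite_of_encard_eq_coe (k := 5) hX
    have hZd : (distanceValues Z).Finite := hXfin.subset (mono hZX)
    have hZne : (distanceValues Z).Nonempty := by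
      obtain ⟨x, y, hx, hy, hxy⟩ := Set.one_lt_encard_iff.1 (hZ.symm ▸ by norm_num : 1 < Z.encard)
      exact ⟨_, x, hx, y, hy, hxy, rfl⟩
    obtain ⟨D, hD⟩ : ∃ D, IsGreatest (distanceValues Z) D := by
      obtain ⟨D, hD, hmax⟩ := hZd.exists_maximal hZne
      exact ⟨D, hD, fun r hr => (le_total r D).elim id (hmax hr)⟩
    have hYD : distanceValues Y ⊆ distanceValues X \ {D} := by
      intro r hr
      refine ⟨mono (hYZ.trans hZX) hr, ?_⟩
      rintro rfl
      obtain ⟨_, ⟨x, hx, rfl⟩, _, ⟨y, hy, rfl⟩, hxy, hr⟩ := hr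
      refine hI x hx y hy ?_
      show IsGreatest (distanceValues Z) _
      rw [hr]
      exact hD
    have hle : (distanceValues Y).encard ≤ 4 := by
      have h1 := Set.encard_sdiff_singleton_add_one (mono hZX hD.1)
      rw [show (distanceValues X).encard = 5 from hX] at h1
      have h2 : (distanceValues X \ {D}).encard = 4 := by
        have h3 : (distanceValues X \ {D}).encard + 1 = 4 + 1 := by rw [h1]; norm_num
        exact ENat.add_left_injective_of_ne_top ENat.one_ne_top h3
      exact h2 ▸ Set.encard_le_encard hYD
    have hYd : (distanceValues Y).Finite := hXfin.subset (hYD.trans Set.sdiff_subset)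
    refine ⟨(distanceValues Y).ncard, ?_, Y, hYZ.trans hZX, ?_, ?_⟩
    · rw [← hYd.cast_ncard_eq] at hle
      exact_mod_cast hle
    · rw [hY, Subtype.val_injective.encard_image, Set.encard_coe_eq_coe_finsetCard, hI8]
      rfl
    · exact hYd.cast_ncard_eq.symm
  · obtain ⟨I, hI8, hI⟩ := exists_indep_eight hX
    have hfin : X.Finite := Set.finite_of_encard_eq_coe (k := 20) hX
    have := hfin.fintype
    rw [← hI8]
    refine SimpleGraph.IsIndepSet.card_le_indepNum ?_
    intro x hx y hy _
    exact hI x hx y hy
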